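/- Let $n\ge 1$, $t\ge 0$ be integers. Let $W\in\mathbb C^{n\times n}$ be a random matrix with i.i.d. proper complex Gaussian entries $W_{ij}\sim\mathcal N_{\mathbb C}(0,1/n)$ (the real and imaginary parts are independent centered real Gaussians of variance $1/(2n)$). Let $(x^{(0)},\dots,x^{(t)})$ be a sequence of random vectors in $\mathbb R^n$, jointly independent of $W$ (the vectors may depend on each other in any way), with $\mathbb E[x^{(s)}x^{(s)\top}]=I_n$ for all $0\le s\le t$. Define $h_{\mathrm{LRU}}^{(0)}=h_{\mathrm{RNN}}^{(0)}=x^{(0)}$, $h_{\mathrm{LRU}}^{(s)}=W h_{\mathrm{LRU}}^{(s-1)}+x^{(s)}$ for $1\le s\le t$, and $h_{\mathrm{RNN}}^{(k)}=W h_{\mathrm{RNN}}^{(k-1)}$ for $k\ge1$, and let $$S_{n,t}=\frac1n\,\mathbb E\bigl[\|h_{\mathrm{LRU}}^{(t)}\|_2^2\bigr],\qquad Q_{n,k}=\frac1n\,\mathbb E\bigl[\|h_{\mathrm{RNN}}^{(k)}\|_2^2\bigr],$$ where the expectation is over both $W$ and the inputs. Then these expectations are finite and $$S_{n,t}=\sum_{k=0}^{t}Q_{n,k},\qquad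 Q_{n,k}=\frac{F^+_{k+2}(n)-F^-_{k+2}(n)}{n^{k+1}(k+1)(k+2)}\quad\text{for every integer }k\ge0,$$ where $F^+_p(n)=n(n+1)\cdots(n+p-1)$ and $F^-_p(n)=n(n-1)\cdots(n-p+1)$. -/

import Mathlib

open MeasureTheory ProbabilityTheory
open scoped NNReal

noncomputable section

/-- The proper (circularly symmetric) complex Gaussian law `𝒩_ℂ(0, v)`: the real and imaginary
parts are independent centered real Gaussians of variance `v / 2` each, so that
`E[Z] = 0`, `E[Z²] = 0` and `E[|Z|²] = v`. -/
def complexGaussian (v : ℝ≥0) : Measure ℂ :=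
  ((gaussianReal 0 (v / 2)).prod (gaussianReal 0 (v / 2))).map
    (fun p : ℝ × ℝ => (⟨p.1, p.2⟩ : ℂ))

/-- Entrywise embedding of a real vector into `ℂⁿ`. -/
def complexify {n : ℕ} (v : Fin n → ℝ) : Fin n → ℂ := fun i => (v i : ℂ)

/-- Hidden state of the linear recurrent unit:
`h⁽⁰⁾ = x⁽⁰⁾` and `h⁽ᵗ⁾ = W h⁽ᵗ⁻¹⁾ + x⁽ᵗ⁾` for `t ≥ 1`. -/
def lruState {n : ℕ} (W : Matrix (Fin n) (Fin n) ℂ) (x : ℕ → Fin n → ℝ) : ℕ → Fin n → ℂ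
  | 0 => complexify (x 0)
  | t + 1 => W.mulVec (lruState W x t) + complexify (x (t + 1))

/-- Hidden state of the linear recurrent network with initial input `x0`:
`h⁽⁰⁾ = x0` and `h⁽ᵗ⁾ = W h⁽ᵗ⁻¹⁾` for `t ≥ 1`. -/
def rnnState {n : ℕ} (W : Matrix (Fin n) (Fin n) ℂ) (x0 : Fin n → ℝ) : ℕ → Fin n → ℂ
  | 0 => complexify x0
  | t + 1 => W.mulVec (rnnState W x0 t)

/-- Squared Euclidean norm of a vector in `ℂⁿ`. -/
def sqNorm {n : ℕ} (h : Fin n → ℂ) : ℝ := ‖WithLp.toLp 2 h‖ ^ 2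

/-- Signal energy of a random hidden state `h`: `(1/n) E[‖h‖₂²]`. -/
def signalEnergy {Ω : Type*} [MeasurableSpace Ω] (P : Measure Ω) {n : ℕ}
    (h : Ω → Fin n → ℂ) : ℝ :=
  (1 / (n : ℝ)) * ∫ ω, sqNorm (h ω) ∂P

/-- The RNN signal energy `Q_{n,k}`, for random weights `W` and random inputs `x`. -/
def rnnEnergy {Ω : Type*} [MeasurableSpace Ω] (P : Measure Ω) {n : ℕ}
    (W : Ω → Matrix (Fin n) (Fin n) ℂ) (x : ℕ → Ω → Fin n → ℝ) (k : ℕ) : ℝ :=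
  signalEnergy P (fun ω => rnnState (W ω) (x 0 ω) k)

/-- The LRU signal energy `S_{n,t}`, for random weights `W` and random inputs `x`. -/
def lruEnergy {Ω : Type*} [MeasurableSpace Ω] (P : Measure Ω) {n : ℕ}
    (W : Ω → Matrix (Fin n) (Fin n) ℂ) (x : ℕ → Ω → Fin n → ℝ) (t : ℕ) : ℝ :=
  signalEnergy P (fun ω => lruState (W ω) (fun s => x s ω) t)

end

/-! Unrolling the recursion gives `h_LRU = ∑ W^(t-s) x_s`. The entries of `W^a` are homogeneous
polynomials of degree `a` in i.i.d. circular Gaussians, so powers with different exponents are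
orthogonal in L². The cross terms of the energy therefore vanish whatever the dependence between
inputs. By independence and identity covariance, each remaining term is `E ‖W^k‖_F²`, which is also
the second moment of the RNN state.

To compute `E ‖W^k‖_F²`, put `⟨f, g⟩ = E[f conj g]`. Multiplication by a variable is adjoint to `v`
times the derivative in it (`gaussianPairing_X_mul`), so left multiplication by the generic matrix
`G` is adjoint to `v D`, with `D` the matrix divergence. Hence `E ‖G^k‖_F² = v^k E[tr D^k G^k]`, and
only the polynomial `tr D^k G^k`, a constant, is needed.

`D` acts badly on `G^k` but well on the coefficients `C_m` of `det(1 - zG)^(-α) (1 - zG)^(-1)` for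
`α = ±1`: `D C_(m+1) = (n + α(m+1)) C_m` (`matrixDivergence_resolventCoeff`). With `c_m` the
coefficients of `det(1 - zG)^(-α)`, inserting `det^(-1) det = 1` writes `G^k` as the sum of `c_a
C_b` over `a + b = k`, with `α = 1` for `c` and `α = -1` for `C`. Each term is evaluated as a
product of factors `n + i` and `n - i` (`traceDivergencePow_hook`), and two telescoping sums give
the closed form. -/

/-! ### Generating-function identities for the recursion `C (m + 1) = c (m + 1) + G C m` -/

section MatrixRecursion

variable {ι R : Type*} [Fintype ι] [DecidableEq ι] [CommRing R]

/-- Unrolling the recursion gives `C m = ∑ G^i c_(m-i)`; multiply by `G^j` and take traces. -/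
theorem trace_pow_mul_of_recursion {G : Matrix ι ι R} {C : ℕ → Matrix ι ι R} {c : ℕ → R}
    (h0 : C 0 = c 0 • 1) (hC : ∀ m, C (m + 1) = c (m + 1) • 1 + G * C m) (m j : ℕ) :
    (G ^ j * C m).trace = ∑ i ∈ Finset.range (m + 1), (G ^ (j + i)).trace * c (m - i) := by
  induction m generalizing j with
  | zero => simp [h0, mul_comm]
  | succ m ih =>
    rw [Finset.sum_range_succ', hC, mul_add, ← mul_assoc, ← pow_succ,
      Matrix.trace_add, ih, add_comm]
    simp [add_assoc, add_comm 1, mul_comm]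

/-- The solution `T` of `T (m + 1) j = f (m + 1) j + T m (j + 1)`, `T 0 = 0`. -/
theorem eq_sum_of_shift_recursion {M : Type*} [AddCommMonoid M] {T f : ℕ → ℕ → M}
    (h0 : ∀ j, T 0 j = 0) (hT : ∀ m j, T (m + 1) j = f (m + 1) j + T m (j + 1)) (m j : ℕ) :
    T m j = ∑ i ∈ Finset.range m, f (m - i) (j + i) := by
  induction m generalizing j with
  | zero => simp [h0]
  | succ m ih =>
    rw [Finset.sum_range_succ', hT, ih, add_comm]
    simp [add_assoc, add_comm 1]

/-- This is the inductive step for the power-sum part of `sum_trace_add_pow_mul_resolventCoeff`: the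
scalar parts of the `C (m - i)` collect into `tr (G C m)`, and the rest keeps a factor `G`. -/
theorem sum_trace_pow_smul_of_recursion {G : Matrix ι ι R} {C : ℕ → Matrix ι ι R} {c : ℕ → R}
    (h0 : C 0 = c 0 • 1) (hC : ∀ m, C (m + 1) = c (m + 1) • 1 + G * C m) (m : ℕ) :
    ∑ i ∈ Finset.range (m + 1), (G ^ (1 + i)).trace • C (m - i) =
      (G * C m).trace • 1 +
        G * ∑ i ∈ Finset.range m, (G ^ (1 + i)).trace • C (m - 1 - i) := by
  have hN := trace_pow_mul_of_recursion h0 hC m 1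
  rw [pow_one] at hN
  rw [hN, Finset.sum_range_succ, Finset.sum_range_succ, add_smul, Finset.sum_smul,
    Finset.mul_sum, add_right_comm, ← Finset.sum_add_distrib]
  congr 1
  · refine Finset.sum_congr rfl fun i hi => ?_
    obtain ⟨k, rfl⟩ := Nat.exists_eq_add_of_lt (Finset.mem_range.1 hi)
    have e2 : i + k + 1 - i = k + 1 := by omega
    have e3 : i + k + 1 - 1 - i = k := by omega
    rw [e2, e3, hC, smul_add, Matrix.mul_smul, smul_smul]
  · simp [h0, smul_smul]

theorem sum_pow_mul_succ (G : Matrix ι ι R) (C : ℕ → Matrix ι ι R) (m : ℕ) :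
    ∑ i ∈ Finset.range (m + 1), G ^ (1 + i) * C (m - i) =
      G * C m + G * ∑ i ∈ Finset.range m, G ^ (1 + i) * C (m - 1 - i) := by
  rw [Finset.sum_range_succ', add_comm, Finset.mul_sum]
  congr 1
  · simp
  · refine Finset.sum_congr rfl fun i _ => ?_
    rw [← mul_assoc, ← pow_succ', Nat.sub_sub m 1 i, add_comm 1 i, add_comm 1 (i + 1)]

end MatrixRecursion

/-! ### Differential calculus of the generic matrix and of the coefficients of `det(1 - zG)^(-α)` -/

noncomputable section GenericMatrix

open MvPolynomial

variable {ι : Type*} [Fintype ι]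

/-- The generic square matrix, whose `(i, j)` entry is the indeterminate `X (i, j)`. -/
def genericMatrix (ι : Type*) : Matrix ι ι (MvPolynomial (ι × ι) ℂ) :=
  Matrix.of fun i j => X (i, j)

/-- The gradient `(∇f)_{ab} = ∂f / ∂G_{ba}` with respect to the transposed generic matrix. -/
def matrixGradient (f : MvPolynomial (ι × ι) ℂ) : Matrix ι ι (MvPolynomial (ι × ι) ℂ) :=
  Matrix.of fun a b => pderiv (b, a) f

/-- The divergence `(DΦ)_{ac} = ∑_b ∂Φ_{bc} / ∂G_{ba}` of a matrix of polynomials. -/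
def matrixDivergence :
    Matrix ι ι (MvPolynomial (ι × ι) ℂ) →ₗ[ℂ] Matrix ι ι (MvPolynomial (ι × ι) ℂ) where
  toFun Φ := Matrix.of fun a c => ∑ b, pderiv (b, a) (Φ b c)
  map_add' Φ Ψ := by
    ext1 a c
    simp [Finset.sum_add_distrib]
  map_smul' r Φ := by
    ext1 a c
    simp [Finset.smul_sum]

local notation "𝐆" => genericMatrix ι
local notation "𝐃" => matrixDivergence (ι := ι)

theorem matrixDivergence_apply (Φ : Matrix ι ι (MvPolynomial (ι × ι) ℂ)) (a c : ι) :
    𝐃 Φ a c = ∑ b, pderiv (b, a) (Φ b c) := rfl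

theorem matrixDivergence_smul (f : MvPolynomial (ι × ι) ℂ)
    (Φ : Matrix ι ι (MvPolynomial (ι × ι) ℂ)) :
    𝐃 (f • Φ) = matrixGradient f * Φ + f • 𝐃 Φ := by
  ext1 a c
  simp only [matrixDivergence_apply, Matrix.smul_apply, smul_eq_mul, Derivation.leibniz,
    Matrix.add_apply, Matrix.mul_apply, matrixGradient, Matrix.of_apply, Finset.mul_sum,
    Finset.sum_add_distrib]
  rw [add_comm]
  simp only [mul_comm]

theorem map_derivation_mul (d : Derivation ℂ (MvPolynomial (ι × ι) ℂ) (MvPolynomial (ι × ι) ℂ))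
    (M N : Matrix ι ι (MvPolynomial (ι × ι) ℂ)) :
    (M * N).map d = M.map d * N + M * N.map d := by
  ext1 a c
  simp only [Matrix.map_apply, Matrix.mul_apply, map_sum, Derivation.leibniz, Matrix.add_apply,
    Finset.sum_add_distrib, smul_eq_mul]
  rw [add_comm]
  simp only [mul_comm]

theorem map_pderiv_generic {ι : Type*} [DecidableEq ι] (a b : ι) :
    (genericMatrix ι).map (pderiv (b, a)) = Matrix.single b a 1 := by
  ext1 i j
  simp [genericMatrix, pderiv_X, Pi.single_apply, Matrix.single_apply, eq_comm]

variable [DecidableEq ι]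

theorem matrixDivergence_scalar (f : MvPolynomial (ι × ι) ℂ) :
    𝐃 (f • 1) = matrixGradient f := by
  have h : 𝐃 1 = 0 := by
    ext1 a c
    simp only [matrixDivergence_apply, Matrix.one_apply, Matrix.zero_apply]
    refine Finset.sum_eq_zero fun b _ => ?_
    split_ifs <;> simp
  rw [matrixDivergence_smul, h, smul_zero, add_zero, mul_one]

/-- Product rule: differentiating the right factor `G` contracts the indices of `Φ` into its trace.
-/
theorem matrixDivergence_mul_generic (Φ : Matrix ι ι (MvPolynomial (ι × ι) ℂ)) :
    𝐃 (Φ * 𝐆) = 𝐃 Φ * 𝐆 + Φ.trace • 1 := by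
  ext1 a c
  simp only [matrixDivergence_apply, Matrix.mul_apply, map_sum, Derivation.leibniz, genericMatrix,
    Matrix.of_apply, pderiv_X, Matrix.add_apply, Matrix.smul_apply, Matrix.trace, Matrix.diag,
    Finset.sum_add_distrib, smul_eq_mul, Pi.single_apply, Prod.mk.injEq, Matrix.one_apply]
  rw [add_comm]
  congr 1
  · rw [Finset.sum_comm]
    refine Finset.sum_congr rfl fun d _ => ?_
    rw [Finset.sum_mul]
    exact Finset.sum_congr rfl fun b _ => mul_comm _ _
  · rw [Finset.sum_mul]
    refine Finset.sum_congr rfl fun b _ => ?_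
    by_cases h : a = c
    · subst h; simp
    · simp [h, Ne.symm h]

/-- The matrices `C_m = ∑_j c_{m-j} G^j`, where `∑ c_m z^m = det (1 - z G)^{-α}`. -/
def resolventCoeff (ι : Type*) [Fintype ι] [DecidableEq ι] (α : ℂ) :
    ℕ → Matrix ι ι (MvPolynomial (ι × ι) ℂ)
  | 0 => 1
  | m + 1 =>
    ((α / ((m : ℂ) + 1)) • (genericMatrix ι * resolventCoeff ι α m).trace) • 1 +
      genericMatrix ι * resolventCoeff ι α m

/-- The coefficients `c_m` of `det (1 - z G)^{-α}`, defined through Newton's identities. -/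
def detPowCoeff (ι : Type*) [Fintype ι] [DecidableEq ι] (α : ℂ) : ℕ → MvPolynomial (ι × ι) ℂ
  | 0 => 1
  | m + 1 => (α / ((m : ℂ) + 1)) • (genericMatrix ι * resolventCoeff ι α m).trace

local notation "𝐂" => resolventCoeff ι
local notation "𝐜" => detPowCoeff ι

theorem resolventCoeff_succ (α : ℂ) (m : ℕ) :
    𝐂 α (m + 1) = 𝐜 α (m + 1) • 1 + 𝐆 * 𝐂 α m := rfl

theorem detPowCoeff_newton (α : ℂ) (m : ℕ) :
    ((m : ℂ) + 1) • 𝐜 α (m + 1) = α • (𝐆 * 𝐂 α m).trace := by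
  have h : (m : ℂ) + 1 ≠ 0 := by exact_mod_cast m.succ_ne_zero
  rw [detPowCoeff, smul_smul, mul_div_cancel₀ _ h]

theorem resolventCoeff_commute {M : Matrix ι ι (MvPolynomial (ι × ι) ℂ)} (hM : Commute 𝐆 M)
    (α : ℂ) (m : ℕ) : Commute (𝐂 α m) M := by
  induction m with
  | zero => exact Commute.one_left M
  | succ m ih =>
    rw [resolventCoeff_succ]
    exact ((Commute.one_left M).smul_left _).add_left (hM.mul_left ih)

theorem resolventCoeff_commute_generic (α : ℂ) (m : ℕ) : Commute (𝐂 α m) 𝐆 :=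
  resolventCoeff_commute (Commute.refl _) α m

theorem resolventCoeff_commute_resolventCoeff (α β : ℂ) (m k : ℕ) :
    Commute (𝐂 α m) (𝐂 β k) :=
  resolventCoeff_commute (resolventCoeff_commute_generic β k).symm α m

theorem resolventCoeff_zero (α : ℂ) : 𝐂 α 0 = 𝐜 α 0 • 1 := by
  simp [resolventCoeff, detPowCoeff]

theorem map_derivation_resolventCoeff
    (d : Derivation ℂ (MvPolynomial (ι × ι) ℂ) (MvPolynomial (ι × ι) ℂ)) (α : ℂ) (m : ℕ) :
    (𝐂 α (m + 1)).map d =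
      d (𝐜 α (m + 1)) • 1 + (𝐆).map d * 𝐂 α m + 𝐆 * (𝐂 α m).map d := by
  rw [resolventCoeff_succ, Matrix.map_add _ (map_add d), map_derivation_mul, add_assoc]
  congr 1
  ext1 i j
  simp only [Matrix.map_apply, Matrix.smul_apply, Matrix.one_apply]
  split_ifs <;> simp

/-- The differentiated recursion has the same shape as the original, with an additional source term
from `d G`; it is unrolled down to index 0, where the derivative vanishes. -/
theorem trace_pow_mul_map_resolventCoeff
    (d : Derivation ℂ (MvPolynomial (ι × ι) ℂ) (MvPolynomial (ι × ι) ℂ)) (α : ℂ) (m j : ℕ) :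
    (𝐆 ^ j * (𝐂 α m).map d).trace =
      ∑ i ∈ Finset.range m, ((𝐆 ^ (j + i)).trace * d (𝐜 α (m - i)) +
        (𝐆 ^ (j + i) * (𝐆).map d * 𝐂 α (m - i - 1)).trace) := by
  refine eq_sum_of_shift_recursion (T := fun m j => (𝐆 ^ j * (𝐂 α m).map d).trace)
    (f := fun m j => (𝐆 ^ j).trace * d (𝐜 α m) + (𝐆 ^ j * (𝐆).map d * 𝐂 α (m - 1)).trace)
    (fun j => ?_) (fun m j => ?_) m j
  · have : (𝐂 α 0).map d = 0 := by
      ext1 i j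
      simp only [resolventCoeff, Matrix.map_apply, Matrix.one_apply, Matrix.zero_apply]
      split_ifs <;> simp
    simp only [this, mul_zero, Matrix.trace_zero]
  · simp only [map_derivation_resolventCoeff, mul_add, ← mul_assoc, ← pow_succ, Matrix.trace_add,
      Nat.add_sub_cancel, Matrix.mul_smul, mul_one, Matrix.trace_smul, smul_eq_mul]
    rw [mul_comm (d _)]

theorem trace_mul_single_mul (M N : Matrix ι ι (MvPolynomial (ι × ι) ℂ)) (a b : ι) :
    (M * Matrix.single b a 1 * N).trace = (N * M) a b := by
  rw [mul_assoc, Matrix.trace_mul_comm, mul_assoc, Matrix.trace_single_mul, one_smul]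

/-- Coefficient form of `z d/dz` applied to `det(1 - zG)^(-α) (1 - zG)^(-1)`: the determinant
contributes `α tr(zG(1 - zG)^(-1))` and the resolvent contributes `zG(1 - zG)^(-1)`. -/
theorem sum_trace_add_pow_mul_resolventCoeff (α : ℂ) (m : ℕ) :
    α • ∑ i ∈ Finset.range m, (𝐆 ^ (1 + i)).trace • 𝐂 α (m - 1 - i) +
      ∑ i ∈ Finset.range m, 𝐆 ^ (1 + i) * 𝐂 α (m - 1 - i) = (m : ℂ) • 𝐂 α m := by
  induction m with
  | zero => simp
  | succ m ih =>
    rw [Nat.add_sub_cancel, sum_trace_pow_smul_of_recursion (resolventCoeff_zero α)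
      (resolventCoeff_succ α), sum_pow_mul_succ, smul_add, add_add_add_comm, ← Matrix.mul_smul,
      ← mul_add, ih, ← smul_assoc, ← detPowCoeff_newton, resolventCoeff_succ, smul_add,
      Matrix.mul_smul, smul_assoc, add_assoc, Nat.cast_succ]
    congr 1
    rw [add_smul (m : ℂ) 1, one_smul, add_comm]

/-- Coefficient form of Jacobi's formula: the gradient of `det(1 - zG)^(-α)` is `α z det(1 -
zG)^(-α) (1 - zG)^(-1)`. -/
theorem matrixGradient_detPowCoeff (α : ℂ) (m : ℕ) :
    matrixGradient (𝐜 α (m + 1)) = α • 𝐂 α m := by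
  induction m using Nat.strong_induction_on with
  | _ m ih =>
    ext1 a b
    have h0 : (m : ℂ) + 1 ≠ 0 := by exact_mod_cast m.succ_ne_zero
    have ih' : ∀ k < m, pderiv (b, a) (𝐜 α (k + 1)) = α • 𝐂 α k a b := fun k hk =>
      congrFun (congrFun (ih k hk) a) b
    have hT := trace_pow_mul_map_resolventCoeff (ι := ι) (pderiv (b, a)) α m 1
    have hsum := congrFun (congrFun (sum_trace_add_pow_mul_resolventCoeff (ι := ι) α m) a) b
    -- By the induction hypothesis, the unrolled derivative of `C m` becomes exactly the Euler-type
    -- sum in `hsum`.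
    have hT' : (𝐆 * (𝐂 α m).map (pderiv (b, a))).trace = (m : ℂ) • 𝐂 α m a b := by
      rw [pow_one] at hT
      rw [hT, ← Matrix.smul_apply, ← hsum, Matrix.add_apply, Matrix.smul_apply, Matrix.sum_apply,
        Matrix.sum_apply, Finset.smul_sum, ← Finset.sum_add_distrib]
      refine Finset.sum_congr rfl fun i hi => ?_
      obtain ⟨k, rfl⟩ := Nat.exists_eq_add_of_lt (Finset.mem_range.1 hi)
      have e2 : i + k + 1 - i = k + 1 := by omega
      have e3 : i + k + 1 - 1 - i = k := by omega
      rw [e2, e3, Nat.add_sub_cancel, ih' k (by omega), map_pderiv_generic, trace_mul_single_mul,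
        ((resolventCoeff_commute_generic α k).pow_right (1 + i)).eq,
        Matrix.smul_apply, smul_eq_mul, mul_smul_comm]
    -- Differentiate Newton's identity: `∂G` contributes one copy of `C m` and `∂(C m)` contributes
    -- `m` copies, so the factor `m + 1` cancels.
    have hd : pderiv (b, a) (((m : ℂ) + 1) • 𝐜 α (m + 1)) =
        α • (((m : ℂ) + 1) • 𝐂 α m a b) := by
      rw [detPowCoeff_newton, Derivation.map_smul]
      congr 1
      have : pderiv (b, a) (𝐆 * 𝐂 α m).trace = ((𝐆 * 𝐂 α m).map (pderiv (b, a))).trace := by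
        simp [Matrix.trace]
      rw [this, map_derivation_mul, Matrix.trace_add, hT', map_pderiv_generic, add_smul, one_smul,
        add_comm]
      congr 1
      have := trace_mul_single_mul 1 (𝐂 α m) a b
      simpa using this
    rw [Derivation.map_smul, smul_comm] at hd
    exact smul_right_injective _ h0 hd

/-- The condition `α² = 1` turns Newton's identity into `tr C_m = (n + αm) c_m`. In the divergence
of `c_(m+1) + C_m G`, the trace term then carries the same factor as `D(C_m) G`, and the two
reassemble into a multiple of a single `C`. -/
theorem matrixDivergence_resolventCoeff {α : ℂ} (hα : α * α = 1) (m : ℕ) :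
    𝐃 (𝐂 α (m + 1)) = ((Fintype.card ι : ℂ) + α * ((m : ℂ) + 1)) • 𝐂 α m := by
  have htr : ∀ m, (𝐂 α m).trace = ((Fintype.card ι : ℂ) + α * m) • 𝐜 α m := by
    intro m
    cases m with
    | zero => simp [resolventCoeff, detPowCoeff, Algebra.smul_def]
    | succ m =>
      have h : (𝐆 * 𝐂 α m).trace = α • (((m : ℂ) + 1) • 𝐜 α (m + 1)) := by
        rw [detPowCoeff_newton, smul_smul, hα, one_smul]
      rw [resolventCoeff_succ, Matrix.trace_add, h, Matrix.trace_smul, Matrix.trace_one]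
      push_cast
      simp only [Algebra.smul_def, map_add, map_mul, map_natCast, map_one, Algebra.algebraMap_self,
        RingHom.id_apply]
      ring
  have hstep : ∀ m, 𝐃 (𝐂 α (m + 1)) =
      α • 𝐂 α m + (𝐃 (𝐂 α m) * 𝐆 + (𝐂 α m).trace • 1) := by
    intro m
    rw [resolventCoeff_succ, map_add, matrixDivergence_scalar, matrixGradient_detPowCoeff,
      ← (resolventCoeff_commute_generic α m).eq, matrixDivergence_mul_generic]
  induction m with
  | zero =>
    rw [hstep, htr]
    have : 𝐃 (𝐂 α 0) = 0 := by
      ext1 a c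
      simp only [resolventCoeff, matrixDivergence_apply, Matrix.one_apply, Matrix.zero_apply]
      refine Finset.sum_eq_zero fun b _ => ?_
      split_ifs <;> simp
    rw [this]
    simp [detPowCoeff, resolventCoeff, add_smul, add_comm]
  | succ m ih =>
    rw [hstep, htr, ih, resolventCoeff_succ (m := m), Matrix.smul_mul,
      (resolventCoeff_commute_generic α m).eq]
    push_cast
    rw [smul_assoc, ← smul_add, add_comm (𝐆 * 𝐂 α m), ← add_smul]
    congr 1
    ring

end GenericMatrix

/-! ### Products of shifted factors and their telescoping sums -/

section Telescoping

/-- `∏_{i=1}^{a} (x + i)` -/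
def upperProd (x : ℂ) (a : ℕ) : ℂ := ∏ i ∈ Finset.range a, (x + ((i : ℂ) + 1))

/-- `∏_{i=1}^{b} (x - i)` -/
def lowerProd (x : ℂ) (b : ℕ) : ℂ := ∏ i ∈ Finset.range b, (x - ((i : ℂ) + 1))

theorem upperProd_succ (x : ℂ) (a : ℕ) :
    upperProd x (a + 1) = upperProd x a * (x + ((a : ℂ) + 1)) := Finset.prod_range_succ _ _

theorem lowerProd_succ (x : ℂ) (b : ℕ) :
    lowerProd x (b + 1) = lowerProd x b * (x - ((b : ℂ) + 1)) := Finset.prod_range_succ _ _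

@[simp] theorem upperProd_zero (x : ℂ) : upperProd x 0 = 1 := rfl

@[simp] theorem lowerProd_zero (x : ℂ) : lowerProd x 0 = 1 := rfl

theorem natCast_mul_upperProd (n a : ℕ) :
    (n : ℂ) * upperProd n a = (n.ascFactorial (a + 1) : ℂ) := by
  induction a with
  | zero => simp [Nat.ascFactorial_succ]
  | succ a ih =>
    rw [upperProd_succ, ← mul_assoc, ih, Nat.ascFactorial_succ (k := a + 1)]
    push_cast
    ring

theorem natCast_mul_lowerProd (n b : ℕ) :
    (n : ℂ) * lowerProd n b = (n.descFactorial (b + 1) : ℂ) := by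
  induction b with
  | zero => simp
  | succ b ih =>
    rw [lowerProd_succ, ← mul_assoc, ih, Nat.descFactorial_succ (k := b + 1)]
    rcases le_or_gt (b + 1) n with h | h
    · push_cast [Nat.cast_sub h]
      ring
    -- Truncated subtraction is harmless here: the falling factorial already contains the factor `n
    -- - b = 0`.
    · have h' : n - b = 0 := by omega
      simp [h']

/-- Telescoping, since `k + 2 = (x + (k - b + 1)) - (x - (b + 1))` for every `b`. -/
theorem mul_sum_upperProd_mul_lowerProd (x : ℂ) (k : ℕ) :
    ((k : ℂ) + 2) * ∑ b ∈ Finset.range (k + 1), upperProd x (k - b) * lowerProd x b =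
      upperProd x (k + 1) - lowerProd x (k + 1) := by
  have h : ∀ b ∈ Finset.range (k + 1),
      ((k : ℂ) + 2) * (upperProd x (k - b) * lowerProd x b) =
        upperProd x (k + 1 - b) * lowerProd x b -
          upperProd x (k + 1 - (b + 1)) * lowerProd x (b + 1) := by
    intro b hb
    obtain ⟨j, rfl⟩ := Nat.exists_eq_add_of_le (Finset.mem_range_succ_iff.1 hb)
    have e1 : b + j - b = j := by omega
    have e2 : b + j + 1 - b = j + 1 := by omega
    have e3 : b + j + 1 - (b + 1) = j := by omega
    rw [e1, e2, e3, upperProd_succ, lowerProd_succ]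
    push_cast
    ring
  rw [Finset.mul_sum, Finset.sum_congr rfl h,
    Finset.sum_range_sub' (fun b => upperProd x (k + 1 - b) * lowerProd x b)]
  simp

/-- Abel summation: the weight `b + 1` is absorbed by telescoping `b * upperProd x (k - b) *
lowerProd x b`. The boundary value at `b = k` combines with the separate term `lowerProd x k`. -/
theorem mul_sum_succ_mul_upperProd_mul_lowerProd (x : ℂ) (k : ℕ) :
    ((k : ℂ) + 1) * (lowerProd x k + ∑ b ∈ Finset.range k,
        ((b : ℂ) + 1) * (upperProd x (k - 1 - b) * lowerProd x b)) =
      ∑ b ∈ Finset.range (k + 1), upperProd x (k - b) * lowerProd x b := by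
  have h : ∀ b ∈ Finset.range k,
      ((k : ℂ) + 1) * (((b : ℂ) + 1) * (upperProd x (k - 1 - b) * lowerProd x b)) =
        upperProd x (k - b) * lowerProd x b -
        (((b + 1 : ℕ) : ℂ) * (upperProd x (k - (b + 1)) * lowerProd x (b + 1)) -
          (b : ℂ) * (upperProd x (k - b) * lowerProd x b)) := by
    intro b hb
    obtain ⟨j, rfl⟩ := Nat.exists_eq_add_of_lt (Finset.mem_range.1 hb)
    have e1 : b + j + 1 - 1 - b = j := by omega
    have e2 : b + j + 1 - b = j + 1 := by omega
    have e3 : b + j + 1 - (b + 1) = j := by omega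
    rw [e1, e2, e3, upperProd_succ, lowerProd_succ]
    push_cast
    ring
  rw [mul_add, Finset.mul_sum, Finset.sum_congr rfl h, Finset.sum_sub_distrib,
    Finset.sum_range_sub (fun b : ℕ => (b : ℂ) * (upperProd x (k - b) * lowerProd x b)),
    Finset.sum_range_succ]
  simp
  ring

end Telescoping

/-! ### Evaluation of `tr D^k G^k` -/

noncomputable section HookMatrices

open MvPolynomial

variable {ι : Type*} [Fintype ι]

local notation "𝐆" => genericMatrix ι
local notation "𝐃" => matrixDivergence (ι := ι)
local notation "𝐂" => resolventCoeff ι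
local notation "𝐜" => detPowCoeff ι
local notation "𝐧" => ((Fintype.card ι : ℕ) : ℂ)

/-- The polynomial `tr (D^m Φ)`. -/
def traceDivergencePow (m : ℕ) :
    Matrix ι ι (MvPolynomial (ι × ι) ℂ) →ₗ[ℂ] MvPolynomial (ι × ι) ℂ :=
  Matrix.traceLinearMap ι ℂ (MvPolynomial (ι × ι) ℂ) ∘ₗ 𝐃 ^ m

local notation "𝐋" => traceDivergencePow (ι := ι)

theorem traceDivergencePow_zero (Φ : Matrix ι ι (MvPolynomial (ι × ι) ℂ)) :
    𝐋 0 Φ = Φ.trace := rfl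

theorem traceDivergencePow_succ (m : ℕ) (Φ : Matrix ι ι (MvPolynomial (ι × ι) ℂ)) :
    𝐋 (m + 1) Φ = 𝐋 m (𝐃 Φ) := by
  simp [traceDivergencePow, pow_succ]

variable [DecidableEq ι]

/-- Expanding the higher-index factor of each product by its recursion gives the same term `G C_a
C_b`, which cancels. This moves one degree between the two factors at the cost of terms `c • C`. -/
theorem resolventCoeff_mul_resolventCoeff_sub (a b : ℕ) :
    𝐂 1 a * 𝐂 (-1) (b + 1) - 𝐂 1 (a + 1) * 𝐂 (-1) b =
      𝐜 (-1) (b + 1) • 𝐂 1 a - 𝐜 1 (a + 1) • 𝐂 (-1) b := by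
  rw [resolventCoeff_succ, resolventCoeff_succ, mul_add, add_mul, ← mul_assoc,
    (resolventCoeff_commute_generic 1 a).eq, Matrix.mul_smul, Matrix.smul_mul, mul_one, one_mul,
    add_sub_add_right_eq_sub]

theorem matrixDivergence_detPowCoeff_smul_resolventCoeff {α β : ℂ} (hα : α * α = 1) (a b : ℕ) :
    𝐃 (𝐜 β (b + 1) • 𝐂 α (a + 1)) =
      β • (𝐂 β b * 𝐂 α (a + 1)) + (𝐧 + α * ((a : ℂ) + 1)) • (𝐜 β (b + 1) • 𝐂 α a) := by
  rw [matrixDivergence_smul, matrixGradient_detPowCoeff, matrixDivergence_resolventCoeff hα,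
    Matrix.smul_mul, smul_comm (𝐜 β (b + 1))]

/-- The three families need each other. The divergence of `c • C` yields a product `C * C` and a
smaller `c • C`, both one degree lower, while a product `C * C` is reached only through the exchange
identity. The cases with index 0 for `c` are separate because `c_0 = 1` has zero gradient. -/
theorem traceDivergencePow_hook (m : ℕ) : ∀ a b : ℕ, a + b = m →
    𝐋 m (𝐜 1 a • 𝐂 (-1) b) = C (match a with
        | 0 => 𝐧 * lowerProd 𝐧 b
        | a + 1 => ((b : ℂ) + 1) * (𝐧 * upperProd 𝐧 a * lowerProd 𝐧 b)) ∧
    𝐋 m (𝐜 (-1) b • 𝐂 1 a) = C (match b with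
        | 0 => 𝐧 * upperProd 𝐧 a
        | b + 1 => -((a : ℂ) + 1) * (𝐧 * upperProd 𝐧 a * lowerProd 𝐧 b)) ∧
    𝐋 m (𝐂 1 a * 𝐂 (-1) b) = C (𝐧 * upperProd 𝐧 a * lowerProd 𝐧 b) := by
  induction m with
  | zero =>
    intro a b h
    obtain ⟨rfl, rfl⟩ := Nat.add_eq_zero_iff.1 h
    simp [traceDivergencePow_zero, resolventCoeff, detPowCoeff]
  | succ m ih =>
    have h1 : (1 : ℂ) * 1 = 1 := one_mul 1
    have h2 : (-1 : ℂ) * -1 = 1 := by norm_num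
    have huv : ∀ a b : ℕ, a + b = m + 1 →
        𝐋 (m + 1) (𝐜 1 a • 𝐂 (-1) b) = C (match a with
          | 0 => 𝐧 * lowerProd 𝐧 b
          | a + 1 => ((b : ℂ) + 1) * (𝐧 * upperProd 𝐧 a * lowerProd 𝐧 b)) ∧
        𝐋 (m + 1) (𝐜 (-1) b • 𝐂 1 a) = C (match b with
          | 0 => 𝐧 * upperProd 𝐧 a
          | b + 1 => -((a : ℂ) + 1) * (𝐧 * upperProd 𝐧 a * lowerProd 𝐧 b)) := by
      intro a b h
      rcases a with _ | a <;> rcases b with _ | b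
      · omega
      · obtain rfl : b = m := by omega
        have hV := (ih 0 b (by omega)).1
        simp only [detPowCoeff, one_smul] at hV
        simp only [traceDivergencePow_succ, resolventCoeff_zero, detPowCoeff, one_smul,
          matrixDivergence_resolventCoeff h2, matrixDivergence_scalar, map_smul, hV]
        rw [← detPowCoeff, matrixGradient_detPowCoeff, map_smul, hV, smul_eq_C_mul, smul_eq_C_mul,
          ← C_mul, ← C_mul, lowerProd_succ]
        constructor <;> congr 1
        · ring
        · simp
      · obtain rfl : a = m := by omega
        have hU := (ih a 0 (by omega)).2.1
        simp only [detPowCoeff, one_smul] at hU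
        simp only [traceDivergencePow_succ, resolventCoeff_zero, detPowCoeff, one_smul,
          matrixDivergence_resolventCoeff h1, matrixDivergence_scalar, map_smul, hU]
        rw [← detPowCoeff, matrixGradient_detPowCoeff, map_smul, hU, smul_eq_C_mul, smul_eq_C_mul,
          ← C_mul, ← C_mul, upperProd_succ]
        constructor <;> congr 1
        · simp
        · ring
      · have hm : a + 1 + b = m := by omega
        have hm' : a + (b + 1) = m := by omega
        have hV := (ih (a + 1) b hm).1
        have hU := (ih a (b + 1) hm').2.1
        have hX := (ih (a + 1) b hm).2.2
        have hX' := (ih a (b + 1) hm').2.2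
        simp only at hV hU
        rw [traceDivergencePow_succ, traceDivergencePow_succ,
          matrixDivergence_detPowCoeff_smul_resolventCoeff h1,
          matrixDivergence_detPowCoeff_smul_resolventCoeff h2, map_add, map_add, LinearMap.map_smul,
          LinearMap.map_smul,
          LinearMap.map_smul, LinearMap.map_smul, hX', hV, (resolventCoeff_commute_resolventCoeff _ _ _ _).eq, hX, hU]
        simp only [smul_eq_C_mul, ← C_mul, ← C_add]
        constructor <;> congr 1
        · rw [lowerProd_succ]
          push_cast
          ring
        · rw [upperProd_succ]
          push_cast
          ring
    suffices hx : ∀ b a : ℕ, a + b = m + 1 →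
        𝐋 (m + 1) (𝐂 1 a * 𝐂 (-1) b) = C (𝐧 * upperProd 𝐧 a * lowerProd 𝐧 b) from
      fun a b h => ⟨(huv a b h).1, (huv a b h).2, hx b a h⟩
    -- At fixed total degree, induct on the `-1` index: at `b = 0` the product is a `c • C` term,
    -- and the exchange identity passes from `(a + 1, b)` to `(a, b + 1)`.
    intro b
    induction b with
    | zero =>
      intro a h
      have := (huv a 0 h).2
      simpa [resolventCoeff, detPowCoeff] using this
    | succ b ihb =>
      intro a h
      have hV := (huv (a + 1) b (by omega)).1
      have hU := (huv a (b + 1) h).2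
      simp only at hV hU
      rw [← sub_add_cancel (𝐂 1 a * 𝐂 (-1) (b + 1)) (𝐂 1 (a + 1) * 𝐂 (-1) b),
        resolventCoeff_mul_resolventCoeff_sub, map_add, map_sub, hU, hV, ihb (a + 1) (by omega),
        ← C_sub, ← C_add]
      congr 1
      rw [upperProd_succ, lowerProd_succ]
      ring

/-- Expanding either factor of `∑ C_a C_b` by its recursion leaves the same remainder `G ∑ C_a C_b`,
one degree lower. -/
theorem sum_detPowCoeff_smul_resolventCoeff_symm (m : ℕ) :
    ∑ p ∈ Finset.HasAntidiagonal.antidiagonal m, 𝐜 (-1) p.2 • 𝐂 1 p.1 =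
      ∑ p ∈ Finset.HasAntidiagonal.antidiagonal m, 𝐜 1 p.1 • 𝐂 (-1) p.2 := by
  cases m with
  | zero => simp [resolventCoeff, detPowCoeff]
  | succ m =>
    have hU : ∑ p ∈ Finset.HasAntidiagonal.antidiagonal (m + 1), 𝐜 (-1) p.2 • 𝐂 1 p.1 +
          ∑ p ∈ Finset.HasAntidiagonal.antidiagonal m, 𝐆 * (𝐂 1 p.1 * 𝐂 (-1) p.2) =
        ∑ p ∈ Finset.HasAntidiagonal.antidiagonal (m + 1), 𝐂 1 p.1 * 𝐂 (-1) p.2 := by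
      rw [Finset.Nat.sum_antidiagonal_succ', Finset.Nat.sum_antidiagonal_succ', add_assoc,
        ← Finset.sum_add_distrib]
      congr 1
      · simp [resolventCoeff, detPowCoeff]
      · refine Finset.sum_congr rfl fun p _ => ?_
        rw [resolventCoeff_succ, mul_add, Matrix.mul_smul, mul_one, ← mul_assoc, ← mul_assoc,
          (resolventCoeff_commute_generic 1 p.1).eq]
    have hV : ∑ p ∈ Finset.HasAntidiagonal.antidiagonal (m + 1), 𝐜 1 p.1 • 𝐂 (-1) p.2 +
          ∑ p ∈ Finset.HasAntidiagonal.antidiagonal m, 𝐆 * (𝐂 1 p.1 * 𝐂 (-1) p.2) =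
        ∑ p ∈ Finset.HasAntidiagonal.antidiagonal (m + 1), 𝐂 1 p.1 * 𝐂 (-1) p.2 := by
      rw [Finset.Nat.sum_antidiagonal_succ, Finset.Nat.sum_antidiagonal_succ, add_assoc,
        ← Finset.sum_add_distrib]
      congr 1
      · simp [resolventCoeff, detPowCoeff]
      · refine Finset.sum_congr rfl fun p _ => ?_
        rw [resolventCoeff_succ, add_mul, Matrix.smul_mul, one_mul, mul_assoc]
    exact add_right_cancel (hU.trans hV.symm)

/-- `det (1 - z G)^{-1} * det (1 - z G) = 1`, coefficientwise. -/
theorem sum_detPowCoeff_mul_detPowCoeff (m : ℕ) :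
    ∑ p ∈ Finset.HasAntidiagonal.antidiagonal (m + 1), 𝐜 1 p.1 * 𝐜 (-1) p.2 = 0 := by
  have hm : ((m : ℂ) + 1) ≠ 0 := by exact_mod_cast m.succ_ne_zero
  -- Weighting by `p.1` or by `p.2` lets Newton's identity apply to one factor. The weights add up
  -- to `m + 1`, and the two traces cancel by the symmetry just proved.
  have h1 : ∑ p ∈ Finset.HasAntidiagonal.antidiagonal (m + 1), (p.1 : ℂ) • (𝐜 1 p.1 * 𝐜 (-1) p.2) =
      (𝐆 * ∑ p ∈ Finset.HasAntidiagonal.antidiagonal m, 𝐜 (-1) p.2 • 𝐂 1 p.1).trace := by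
    rw [Finset.Nat.sum_antidiagonal_succ, Finset.mul_sum, Matrix.trace_sum]
    simp only [Nat.cast_zero, zero_smul, zero_add]
    refine Finset.sum_congr rfl fun p _ => ?_
    rw [Nat.cast_succ, ← smul_mul_assoc, detPowCoeff_newton, one_smul, Matrix.mul_smul,
      Matrix.trace_smul, smul_eq_mul, mul_comm]
  have h2 : ∑ p ∈ Finset.HasAntidiagonal.antidiagonal (m + 1), (p.2 : ℂ) • (𝐜 1 p.1 * 𝐜 (-1) p.2) =
      -(𝐆 * ∑ p ∈ Finset.HasAntidiagonal.antidiagonal m, 𝐜 1 p.1 • 𝐂 (-1) p.2).trace := by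
    rw [Finset.Nat.sum_antidiagonal_succ', Finset.mul_sum, Matrix.trace_sum,
      ← Finset.sum_neg_distrib]
    simp only [Nat.cast_zero, zero_smul, zero_add]
    refine Finset.sum_congr rfl fun p _ => ?_
    rw [Nat.cast_succ, ← mul_smul_comm, detPowCoeff_newton, neg_one_smul, Matrix.mul_smul,
      Matrix.trace_smul, smul_eq_mul, mul_neg]
  have h3 : ((m : ℂ) + 1) • ∑ p ∈ Finset.HasAntidiagonal.antidiagonal (m + 1), 𝐜 1 p.1 * 𝐜 (-1) p.2 = 0 := by
    rw [Finset.smul_sum]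
    trans ∑ p ∈ Finset.HasAntidiagonal.antidiagonal (m + 1), ((p.1 : ℂ) • (𝐜 1 p.1 * 𝐜 (-1) p.2) +
      (p.2 : ℂ) • (𝐜 1 p.1 * 𝐜 (-1) p.2))
    · refine Finset.sum_congr rfl fun p hp => ?_
      rw [← add_smul, ← Nat.cast_add, Finset.HasAntidiagonal.mem_antidiagonal.1 hp, Nat.cast_succ]
    · rw [Finset.sum_add_distrib, h1, h2, sum_detPowCoeff_smul_resolventCoeff_symm, add_neg_cancel]
  exact (smul_eq_zero.1 h3).resolve_left hm

/-- Coefficient of `z^k` in `det(1 - zG)^(-1) · det(1 - zG) (1 - zG)^(-1) = (1 - zG)^(-1)`. -/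
theorem genericMatrix_pow_eq_sum (k : ℕ) :
    𝐆 ^ k = ∑ p ∈ Finset.HasAntidiagonal.antidiagonal k, 𝐜 1 p.1 • 𝐂 (-1) p.2 := by
  induction k with
  | zero => simp [resolventCoeff, detPowCoeff]
  | succ k ih =>
    have h : ∑ p ∈ Finset.HasAntidiagonal.antidiagonal (k + 1), 𝐜 1 p.1 • 𝐂 (-1) p.2 =
        (∑ p ∈ Finset.HasAntidiagonal.antidiagonal (k + 1), 𝐜 1 p.1 * 𝐜 (-1) p.2) • 1 + 𝐆 * 𝐆 ^ k := by
      rw [ih, Finset.Nat.sum_antidiagonal_succ', Finset.Nat.sum_antidiagonal_succ', add_smul,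
        Finset.sum_smul, Finset.mul_sum, add_assoc, ← Finset.sum_add_distrib]
      congr 1
      · simp [resolventCoeff, detPowCoeff]
      · refine Finset.sum_congr rfl fun p _ => ?_
        rw [resolventCoeff_succ, smul_add, smul_smul, Matrix.mul_smul]
    rw [h, sum_detPowCoeff_mul_detPowCoeff, zero_smul, zero_add, pow_succ']

theorem traceDivergencePow_genericMatrix_pow (k : ℕ) :
    𝐋 k (𝐆 ^ k) = C ((((Fintype.card ι).ascFactorial (k + 2) : ℂ) -
      ((Fintype.card ι).descFactorial (k + 2) : ℂ)) / (((k : ℂ) + 1) * ((k : ℂ) + 2))) := by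
  have hk1 : (k : ℂ) + 1 ≠ 0 := by exact_mod_cast k.succ_ne_zero
  have hk2 : (k : ℂ) + 2 ≠ 0 := by exact_mod_cast (k + 1).succ_ne_zero
  rw [genericMatrix_pow_eq_sum, map_sum,
    Finset.Nat.sum_antidiagonal_eq_sum_range_succ (fun i j => 𝐋 k (𝐜 1 i • 𝐂 (-1) j)),
    ← Finset.sum_range_reflect, Finset.sum_range_succ]
  have h0 : 𝐋 k (𝐜 1 (k + 1 - 1 - k) • 𝐂 (-1) (k - (k + 1 - 1 - k))) =
      C (𝐧 * lowerProd 𝐧 k) := by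
    have := (traceDivergencePow_hook (ι := ι) k 0 k (by omega)).1
    simpa using this
  have hs : ∀ b ∈ Finset.range k, 𝐋 k (𝐜 1 (k + 1 - 1 - b) • 𝐂 (-1) (k - (k + 1 - 1 - b))) =
      C (𝐧 * (((b : ℂ) + 1) * (upperProd 𝐧 (k - 1 - b) * lowerProd 𝐧 b))) := by
    intro b hb
    obtain ⟨j, rfl⟩ := Nat.exists_eq_add_of_lt (Finset.mem_range.1 hb)
    have e1 : b + j + 1 + 1 - 1 - b = j + 1 := by omega
    have e2 : b + j + 1 - (j + 1) = b := by omega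
    have e3 : b + j + 1 - 1 - b = j := by omega
    have := (traceDivergencePow_hook (ι := ι) (b + j + 1) (j + 1) b (by omega)).1
    rw [e1, e2, e3, this]
    congr 1
    ring
  rw [h0, Finset.sum_congr rfl hs, ← map_sum, ← C_add]
  congr 1
  rw [eq_div_iff (mul_ne_zero hk1 hk2), ← natCast_mul_upperProd, ← natCast_mul_lowerProd,
    ← mul_sub, ← mul_sum_upperProd_mul_lowerProd, ← mul_sum_succ_mul_upperProd_mul_lowerProd,
    ← Finset.mul_sum]
  ring

end HookMatrices

/-! ### Gaussian integration by parts, real and complex -/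

section GaussianIntegrationByParts

open Polynomial in
theorem integrable_polynomial_gaussianReal (s : ℝ≥0) (f : ℂ[X]) :
    Integrable (fun x : ℝ => f.eval (x : ℂ)) (gaussianReal 0 s) := by
  simp only [Polynomial.eval_eq_sum_range]
  refine integrable_finsetSum _ fun i _ => Integrable.const_mul ?_ _
  have h : Integrable (fun x : ℝ => x ^ i) (gaussianReal 0 s) := by
    have := (memLp_id_gaussianReal (μ := 0) (v := s) i).integrable_norm_pow'
    refine this.mono' (by fun_prop) (ae_of_all _ fun x => ?_)
    simp
  simpa using h.ofReal (𝕜 := ℂ)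

theorem hasDerivAt_gaussianPDFReal_zero {s : ℝ≥0} (hs : s ≠ 0) (x : ℝ) :
    HasDerivAt (gaussianPDFReal 0 s) (-(x / s) * gaussianPDFReal 0 s x) x := by
  have hs' : (s : ℝ) ≠ 0 := by exact_mod_cast hs
  have h : HasDerivAt (fun x : ℝ => -(x - 0) ^ 2 / (2 * s)) (-(x / s)) x := by
    have := (((hasDerivAt_id x).sub_const 0).pow 2).neg.div_const (2 * (s : ℝ))
    refine this.congr_deriv ?_
    simp
    field_simp
  have := h.exp.const_mul (√(2 * Real.pi * s))⁻¹
  rw [gaussianPDFReal_def]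
  refine this.congr_deriv ?_
  ring

theorem integrable_gaussianPDFReal_mul {s : ℝ≥0} (hs : s ≠ 0) {f : ℝ → ℂ}
    (hf : Integrable f (gaussianReal 0 s)) :
    Integrable (fun x => (gaussianPDFReal 0 s x : ℂ) * f x) := by
  rw [gaussianReal_of_var_ne_zero _ hs, integrable_withDensity_iff_integrable_smul'
    (measurable_gaussianPDF _ _) (ae_of_all _ fun _ => gaussianPDF_lt_top)] at hf
  simpa [toReal_gaussianPDF] using hf

open Polynomial in
/-- **Stein's identity** for polynomials. -/
theorem integral_mul_polynomial_gaussianReal {s : ℝ≥0} (hs : s ≠ 0) (f : ℂ[X]) :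
    ∫ x : ℝ, (x : ℂ) * f.eval (x : ℂ) ∂gaussianReal 0 s =
      s * ∫ x : ℝ, (derivative f).eval (x : ℂ) ∂gaussianReal 0 s := by
  have hs' : (s : ℂ) ≠ 0 := by exact_mod_cast hs
  have hXf : Integrable (fun x : ℝ => (x : ℂ) * f.eval (x : ℂ)) (gaussianReal 0 s) := by
    exact (integrable_polynomial_gaussianReal s (X * f)).congr (ae_of_all _ fun x => by simp)
  have hu : ∀ x : ℝ, HasDerivAt (fun x : ℝ => (gaussianPDFReal 0 s x : ℂ))
      (-((x : ℂ) / s) * gaussianPDFReal 0 s x) x := fun x => by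
    simpa using (hasDerivAt_gaussianPDFReal_zero hs x).ofReal_comp
  have h := integral_mul_deriv_eq_deriv_mul_of_integrable
    (u := fun x : ℝ => (gaussianPDFReal 0 s x : ℂ)) (v := fun x : ℝ => f.eval (x : ℂ))
    (u' := fun x : ℝ => -((x : ℂ) / s) * gaussianPDFReal 0 s x)
    (v' := fun x : ℝ => (derivative f).eval (x : ℂ))
    (fun x _ => hu x) (fun x _ => (f.hasDerivAt (x : ℂ)).comp_ofReal)
    (integrable_gaussianPDFReal_mul hs (integrable_polynomial_gaussianReal s _))
    (((integrable_gaussianPDFReal_mul hs hXf).const_mul (-(1 / (s : ℂ)))).congr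
      (ae_of_all _ fun x => by simp; ring))
    (integrable_gaussianPDFReal_mul hs (integrable_polynomial_gaussianReal s _))
  rw [integral_gaussianReal_eq_integral_smul hs, integral_gaussianReal_eq_integral_smul hs]
  simp only [Complex.real_smul]
  rw [h, ← integral_neg, ← integral_const_mul]
  refine integral_congr_ae (ae_of_all _ fun x => ?_)
  simp only
  field_simp

/-- Stein's identity for a product of powers of affine functions. -/
theorem integral_mul_affine_pow_gaussianReal {s : ℝ≥0} (hs : s ≠ 0) (a b c d : ℂ) (p q : ℕ) :
    ∫ x : ℝ, (x : ℂ) * ((a * x + b) ^ p * (c * x + d) ^ q) ∂gaussianReal 0 s =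
      s * ∫ x : ℝ, (p * a * ((a * x + b) ^ (p - 1) * (c * x + d) ^ q) +
        q * c * ((a * x + b) ^ p * (c * x + d) ^ (q - 1))) ∂gaussianReal 0 s := by
  have h := integral_mul_polynomial_gaussianReal hs
    ((Polynomial.C a * Polynomial.X + Polynomial.C b) ^ p *
      (Polynomial.C c * Polynomial.X + Polynomial.C d) ^ q)
  simp only [Polynomial.eval_mul, Polynomial.eval_pow, Polynomial.eval_add, Polynomial.eval_C,
    Polynomial.eval_X, Polynomial.derivative_mul, Polynomial.derivative_pow,
    Polynomial.derivative_add, Polynomial.derivative_C, Polynomial.derivative_X] at h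
  rw [h]
  congr 1
  refine integral_congr_ae (ae_of_all _ fun x => ?_)
  simp
  ring

theorem measurable_complex_mk : Measurable (fun p : ℝ × ℝ => (⟨p.1, p.2⟩ : ℂ)) :=
  Complex.measurableEquivRealProd.symm.measurable

instance (v : ℝ≥0) : IsProbabilityMeasure (complexGaussian v) :=
  Measure.isProbabilityMeasure_map measurable_complex_mk.aemeasurable

theorem complex_mk_eq (p : ℝ × ℝ) : (⟨p.1, p.2⟩ : ℂ) = (p.1 : ℂ) + p.2 * Complex.I := by
  apply Complex.ext <;> simp

theorem memLp_id_complexGaussian (v : ℝ≥0) (m : ℕ) :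
    MemLp (fun z : ℂ => z) m (complexGaussian v) := by
  have h1 : MemLp (fun p : ℝ × ℝ => (p.1 : ℂ)) m
      ((gaussianReal 0 (v / 2)).prod (gaussianReal 0 (v / 2))) :=
    ((memLp_id_gaussianReal (μ := 0) (v := v / 2) m).ofReal (K := ℂ)).comp_measurePreserving
      measurePreserving_fst
  have h2 : MemLp (fun p : ℝ × ℝ => (p.2 : ℂ)) m
      ((gaussianReal 0 (v / 2)).prod (gaussianReal 0 (v / 2))) :=
    ((memLp_id_gaussianReal (μ := 0) (v := v / 2) m).ofReal (K := ℂ)).comp_measurePreserving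
      measurePreserving_snd
  rw [complexGaussian, memLp_map_measure_iff (by fun_prop) measurable_complex_mk.aemeasurable]
  refine (h1.add (h2.mul_const Complex.I)).ae_eq (ae_of_all _ fun p => ?_)
  simp [complex_mk_eq]

theorem integrable_norm_pow_complexGaussian (v : ℝ≥0) (m : ℕ) :
    Integrable (fun z : ℂ => ‖z‖ ^ m) (complexGaussian v) :=
  (memLp_id_complexGaussian v m).integrable_norm_pow'

theorem integrable_pow_mul_conj_pow_complexGaussian (v : ℝ≥0) (p q : ℕ) :
    Integrable (fun z : ℂ => z ^ p * (starRingEnd ℂ) z ^ q) (complexGaussian v) := by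
  refine (integrable_norm_pow_complexGaussian v (p + q)).mono' ?_ (ae_of_all _ fun z => ?_)
  · exact (Continuous.mul (by fun_prop) (Complex.continuous_conj.pow q)).aestronglyMeasurable
  · simp [pow_add]

/-- Mixed moments of a complex Gaussian: integration by parts in the conjugate variable. -/
theorem integral_pow_mul_conj_pow_succ_complexGaussian {v : ℝ≥0} (hv : v ≠ 0) (p q : ℕ) :
    ∫ z, z ^ p * (starRingEnd ℂ) z ^ (q + 1) ∂complexGaussian v =
      v * p * ∫ z, z ^ (p - 1) * (starRingEnd ℂ) z ^ q ∂complexGaussian v := by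
  have hs : v / 2 ≠ 0 := by positivity
  set γ := gaussianReal 0 (v / 2) with hγ
  have hmap : ∀ a b : ℕ, ∫ z, z ^ a * (starRingEnd ℂ) z ^ b ∂complexGaussian v =
      ∫ w : ℝ × ℝ, ((w.1 : ℂ) + w.2 * Complex.I) ^ a * ((w.1 : ℂ) - w.2 * Complex.I) ^ b
        ∂γ.prod γ := by
    intro a b
    rw [complexGaussian, integral_map measurable_complex_mk.aemeasurable
      (integrable_pow_mul_conj_pow_complexGaussian v a b).aestronglyMeasurable]
    refine integral_congr_ae (ae_of_all _ fun w => ?_)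
    simp [complex_mk_eq, sub_eq_add_neg]
  have hint : ∀ a b : ℕ, Integrable (fun w : ℝ × ℝ => ((w.1 : ℂ) + w.2 * Complex.I) ^ a *
      ((w.1 : ℂ) - w.2 * Complex.I) ^ b) (γ.prod γ) := by
    intro a b
    have h := integrable_pow_mul_conj_pow_complexGaussian v a b
    rw [complexGaussian, integrable_map_measure h.aestronglyMeasurable
      measurable_complex_mk.aemeasurable] at h
    refine h.congr (ae_of_all _ fun w => ?_)
    simp [complex_mk_eq, sub_eq_add_neg]
  have hF1 : Integrable (fun w : ℝ × ℝ => (w.1 : ℂ) * (((w.1 : ℂ) + w.2 * Complex.I) ^ p *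
      ((w.1 : ℂ) - w.2 * Complex.I) ^ q)) (γ.prod γ) := by
    refine (((hint (p + 1) q).add (hint p (q + 1))).const_mul (1 / 2)).congr
      (ae_of_all _ fun w => ?_)
    simp only [Pi.add_apply]
    ring
  have hF2 : Integrable (fun w : ℝ × ℝ => (w.2 : ℂ) * (((w.1 : ℂ) + w.2 * Complex.I) ^ p *
      ((w.1 : ℂ) - w.2 * Complex.I) ^ q)) (γ.prod γ) := by
    refine (((hint (p + 1) q).sub (hint p (q + 1))).const_mul (-Complex.I / 2)).congr
      (ae_of_all _ fun w => ?_)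
    simp only [Pi.sub_apply]
    linear_combination (-(w.2 : ℂ) * (((w.1 : ℂ) + w.2 * Complex.I) ^ p *
      ((w.1 : ℂ) - w.2 * Complex.I) ^ q)) * Complex.I_sq
  set A := ∫ w : ℝ × ℝ, ((w.1 : ℂ) + w.2 * Complex.I) ^ (p - 1) *
    ((w.1 : ℂ) - w.2 * Complex.I) ^ q ∂γ.prod γ with hA
  set B := ∫ w : ℝ × ℝ, ((w.1 : ℂ) + w.2 * Complex.I) ^ p *
    ((w.1 : ℂ) - w.2 * Complex.I) ^ (q - 1) ∂γ.prod γ with hB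
  have hcint : ∀ α β : ℂ, Integrable (fun w : ℝ × ℝ =>
      α * (((w.1 : ℂ) + w.2 * Complex.I) ^ (p - 1) * ((w.1 : ℂ) - w.2 * Complex.I) ^ q) +
        β * (((w.1 : ℂ) + w.2 * Complex.I) ^ p * ((w.1 : ℂ) - w.2 * Complex.I) ^ (q - 1)))
      (γ.prod γ) := fun α β => ((hint _ _).const_mul α).add ((hint _ _).const_mul β)
  have hcomb : ∀ α β : ℂ, ∫ w : ℝ × ℝ, (α * (((w.1 : ℂ) + w.2 * Complex.I) ^ (p - 1) *
      ((w.1 : ℂ) - w.2 * Complex.I) ^ q) + β * (((w.1 : ℂ) + w.2 * Complex.I) ^ p *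
      ((w.1 : ℂ) - w.2 * Complex.I) ^ (q - 1))) ∂γ.prod γ = α * A + β * B := by
    intro α β
    rw [integral_add ((hint _ _).const_mul _) ((hint _ _).const_mul _), integral_const_mul,
      integral_const_mul]
  have h1 : ∫ w : ℝ × ℝ, (w.1 : ℂ) * (((w.1 : ℂ) + w.2 * Complex.I) ^ p *
      ((w.1 : ℂ) - w.2 * Complex.I) ^ q) ∂γ.prod γ = ((v / 2 : ℝ≥0) : ℂ) * (p * A + q * B) := by
    rw [integral_prod_symm _ hF1, ← hcomb, integral_prod_symm _ (hcint _ _), ← integral_const_mul]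
    refine integral_congr_ae (ae_of_all _ fun y => ?_)
    have := integral_mul_affine_pow_gaussianReal hs 1 (y * Complex.I) 1 (-(y * Complex.I)) p q
    simpa [sub_eq_add_neg] using this
  have h2 : ∫ w : ℝ × ℝ, (w.2 : ℂ) * (((w.1 : ℂ) + w.2 * Complex.I) ^ p *
      ((w.1 : ℂ) - w.2 * Complex.I) ^ q) ∂γ.prod γ =
      ((v / 2 : ℝ≥0) : ℂ) * (p * Complex.I * A + -(q * Complex.I) * B) := by
    rw [integral_prod _ hF2, ← hcomb, integral_prod _ (hcint _ _), ← integral_const_mul]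
    refine integral_congr_ae (ae_of_all _ fun x => ?_)
    have := integral_mul_affine_pow_gaussianReal hs Complex.I x (-Complex.I) x p q
    simpa [sub_eq_add_neg, add_comm, mul_comm Complex.I] using this
  rw [hmap, hmap]
  -- Write the additional conjugate as `x - iy` and apply Stein's identity in each coordinate: the
  -- `q` terms cancel and the `p` terms double, turning `v / 2` into `v`.
  have h3 : ∫ w : ℝ × ℝ, ((w.1 : ℂ) + w.2 * Complex.I) ^ p *
      ((w.1 : ℂ) - w.2 * Complex.I) ^ (q + 1) ∂γ.prod γ =
      ((v / 2 : ℝ≥0) : ℂ) * (p * A + q * B) -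
        Complex.I * (((v / 2 : ℝ≥0) : ℂ) * (p * Complex.I * A + -(q * Complex.I) * B)) := by
    rw [← h1, ← h2, ← integral_const_mul, ← integral_sub hF1 (hF2.const_mul _)]
    refine integral_congr_ae (ae_of_all _ fun w => ?_)
    simp only
    ring
  rw [h3]
  push_cast
  linear_combination (-(v : ℂ) / 2 * (p * A - q * B)) * Complex.I_sq

end GaussianIntegrationByParts

/-! ### The Gaussian inner product on polynomials -/

noncomputable section PolynomialPairing

open MvPolynomial

variable {σ : Type*} [Fintype σ]

/-- `E[f(Z) * conj (g(Z))]` for i.i.d. complex Gaussians `Z` of variance `v`. -/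
def gaussianPairing (v : ℝ≥0) (f g : MvPolynomial σ ℂ) : ℂ :=
  ∫ z, eval z f * (starRingEnd ℂ) (eval z g) ∂Measure.pi fun _ : σ => complexGaussian v

theorem eval_monomial_mul_conj (α β : σ →₀ ℕ) (a b : ℂ) (z : σ → ℂ) :
    eval z (monomial α a) * (starRingEnd ℂ) (eval z (monomial β b)) =
      (a * (starRingEnd ℂ) b) * ∏ i, (z i ^ α i * (starRingEnd ℂ) (z i) ^ β i) := by
  rw [eval_monomial, eval_monomial, Finsupp.prod_fintype _ _ (by simp),
    Finsupp.prod_fintype _ _ (by simp), Finset.prod_mul_distrib]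
  simp only [map_mul, map_prod, map_pow]
  ring

theorem integrable_eval_mul_conj_eval (v : ℝ≥0) (f g : MvPolynomial σ ℂ) :
    Integrable (fun z => eval z f * (starRingEnd ℂ) (eval z g))
      (Measure.pi fun _ : σ => complexGaussian v) := by
  induction f using induction_on' with
  | add f f' hf hf' =>
    simp only [map_add, add_mul]
    exact hf.add hf'
  | monomial α a =>
    induction g using induction_on' with
    | add g g' hg hg' =>
      simp only [map_add, mul_add]
      exact hg.add hg'
    | monomial β b =>
      simp only [eval_monomial_mul_conj]
      exact (Integrable.fintype_prod fun i =>
        integrable_pow_mul_conj_pow_complexGaussian v (α i) (β i)).const_mul _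

theorem gaussianPairing_add_left (v : ℝ≥0) (f f' g : MvPolynomial σ ℂ) :
    gaussianPairing v (f + f') g = gaussianPairing v f g + gaussianPairing v f' g := by
  simp only [gaussianPairing, map_add, add_mul]
  exact integral_add (integrable_eval_mul_conj_eval v f g) (integrable_eval_mul_conj_eval v f' g)

theorem gaussianPairing_add_right (v : ℝ≥0) (f g g' : MvPolynomial σ ℂ) :
    gaussianPairing v f (g + g') = gaussianPairing v f g + gaussianPairing v f g' := by
  simp only [gaussianPairing, map_add, mul_add]
  exact integral_add (integrable_eval_mul_conj_eval v f g) (integrable_eval_mul_conj_eval v f g')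

theorem gaussianPairing_conj (v : ℝ≥0) (f g : MvPolynomial σ ℂ) :
    (starRingEnd ℂ) (gaussianPairing v f g) = gaussianPairing v g f := by
  rw [gaussianPairing, gaussianPairing, ← integral_conj]
  simp [mul_comm]

theorem gaussianPairing_sum_left {κ : Type*} (v : ℝ≥0) (s : Finset κ) (f : κ → MvPolynomial σ ℂ)
    (g : MvPolynomial σ ℂ) :
    gaussianPairing v (∑ i ∈ s, f i) g = ∑ i ∈ s, gaussianPairing v (f i) g := by
  simp only [gaussianPairing, map_sum, Finset.sum_mul]
  exact integral_finsetSum _ fun i _ => integrable_eval_mul_conj_eval v (f i) g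

theorem gaussianPairing_sum_right {κ : Type*} (v : ℝ≥0) (s : Finset κ) (f : MvPolynomial σ ℂ)
    (g : κ → MvPolynomial σ ℂ) :
    gaussianPairing v f (∑ i ∈ s, g i) = ∑ i ∈ s, gaussianPairing v f (g i) := by
  simp only [gaussianPairing, map_sum, Finset.mul_sum]
  exact integral_finsetSum _ fun i _ => integrable_eval_mul_conj_eval v f (g i)

theorem gaussianPairing_smul_left (v : ℝ≥0) (r : ℂ) (f g : MvPolynomial σ ℂ) :
    gaussianPairing v (r • f) g = r * gaussianPairing v f g := by
  simp only [gaussianPairing, smul_eval, mul_assoc]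
  exact integral_const_mul _ _

theorem gaussianPairing_monomial (v : ℝ≥0) (α β : σ →₀ ℕ) (a b : ℂ) :
    gaussianPairing v (monomial α a) (monomial β b) = (a * (starRingEnd ℂ) b) *
      ∏ i, ∫ z, z ^ α i * (starRingEnd ℂ) z ^ β i ∂complexGaussian v := by
  simp only [gaussianPairing, eval_monomial_mul_conj]
  rw [integral_const_mul, integral_fintype_prod_eq_prod
    (fun i (z : ℂ) => z ^ α i * (starRingEnd ℂ) z ^ β i)]

/-- Multiplication by a variable is adjoint to differentiation. -/
theorem gaussianPairing_X_mul {v : ℝ≥0} (hv : v ≠ 0) (f g : MvPolynomial σ ℂ) (i : σ) :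
    gaussianPairing v f (X i * g) = v * gaussianPairing v (pderiv i f) g := by
  classical
  induction f using induction_on' with
  | add f f' hf hf' => rw [map_add, gaussianPairing_add_left, gaussianPairing_add_left, hf, hf',
      mul_add]
  | monomial α a =>
    induction g using induction_on' with
    | add g g' hg hg' => rw [mul_add, gaussianPairing_add_right, gaussianPairing_add_right, hg, hg',
        mul_add]
    | monomial β b =>
      have hX : X i * monomial β b = monomial (β + Finsupp.single i 1) b := by
        rw [monomial_add_single, pow_one, mul_comm]
      have hrest : ∏ j ∈ Finset.univ.erase i,
            ∫ z, z ^ α j * (starRingEnd ℂ) z ^ (β + Finsupp.single i 1 : σ →₀ ℕ) j ∂complexGaussian v =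
          ∏ j ∈ Finset.univ.erase i, ∫ z, z ^ (α - Finsupp.single i 1 : σ →₀ ℕ) j *
            (starRingEnd ℂ) z ^ β j ∂complexGaussian v := by
        refine Finset.prod_congr rfl fun j hj => ?_
        have hj' : i ≠ j := (Finset.ne_of_mem_erase hj).symm
        simp [Finsupp.single_eq_of_ne' hj']
      rw [hX, pderiv_monomial, gaussianPairing_monomial, gaussianPairing_monomial,
        ← Finset.mul_prod_erase _ _ (Finset.mem_univ i),
        ← Finset.mul_prod_erase _ _ (Finset.mem_univ i), hrest]
      simp only [Finsupp.add_apply, Finsupp.single_eq_same, Finsupp.tsub_apply]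
      rw [integral_pow_mul_conj_pow_succ_complexGaussian hv]
      ring

/-- Homogeneous polynomials of different degrees are orthogonal. -/
theorem gaussianPairing_eq_zero_of_isHomogeneous {v : ℝ≥0} (hv : v ≠ 0)
    {f g : MvPolynomial σ ℂ} {a b : ℕ} (hf : f.IsHomogeneous a) (hg : g.IsHomogeneous b)
    (hab : a ≠ b) : gaussianPairing v f g = 0 := by
  -- Each `X i ∂_i` is self-adjoint, hence so is the Euler operator, whose eigenvalue on a
  -- homogeneous polynomial is its degree.
  have hX : ∀ i, gaussianPairing v (X i * pderiv i f) g = gaussianPairing v f (X i * pderiv i g) := by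
    intro i
    rw [gaussianPairing_X_mul hv, ← gaussianPairing_conj, gaussianPairing_X_mul hv, map_mul,
      gaussianPairing_conj]
    simp
  have h : (a : ℂ) * gaussianPairing v f g = b * gaussianPairing v f g := by
    have h1 : (a : ℂ) * gaussianPairing v f g = gaussianPairing v (a • f) g := by
      rw [← gaussianPairing_smul_left, Nat.cast_smul_eq_nsmul]
    have h2 : (b : ℂ) * gaussianPairing v f g = gaussianPairing v f (b • g) := by
      have := congrArg (starRingEnd ℂ) (gaussianPairing_smul_left v (b : ℂ) g f)
      rw [map_mul, gaussianPairing_conj, gaussianPairing_conj, Nat.cast_smul_eq_nsmul] at this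
      simpa using this.symm
    rw [h1, h2, ← hf.sum_X_mul_pderiv, ← hg.sum_X_mul_pderiv, gaussianPairing_sum_left,
      gaussianPairing_sum_right]
    exact Finset.sum_congr rfl fun i _ => hX i
  have : ((a : ℂ) - b) * gaussianPairing v f g = 0 := by rw [sub_mul, h, sub_self]
  exact (mul_eq_zero.1 this).resolve_left (sub_ne_zero.2 (by exact_mod_cast hab))

variable {ι : Type*} [Fintype ι]

/-- Entrywise adjunction; the transposed index in `matrixDivergence` is chosen to make `D` the
adjoint of left multiplication by `G`, up to `v`. -/
theorem sum_gaussianPairing_generic_mul {v : ℝ≥0} (hv : v ≠ 0)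
    (Φ Ψ : Matrix ι ι (MvPolynomial (ι × ι) ℂ)) :
    ∑ i, ∑ j, gaussianPairing v (Φ i j) ((genericMatrix ι * Ψ) i j) =
      v * ∑ i, ∑ j, gaussianPairing v (matrixDivergence Φ i j) (Ψ i j) := by
  simp only [Matrix.mul_apply, genericMatrix, Matrix.of_apply, gaussianPairing_sum_right,
    gaussianPairing_X_mul hv, matrixDivergence_apply, gaussianPairing_sum_left, Finset.mul_sum]
  exact Finset.sum_comm.trans ((Finset.sum_congr rfl fun j _ => Finset.sum_comm).trans
    Finset.sum_comm)

variable [DecidableEq ι]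

theorem sum_gaussianPairing_generic_pow {v : ℝ≥0} (hv : v ≠ 0) (k : ℕ)
    (Φ : Matrix ι ι (MvPolynomial (ι × ι) ℂ)) :
    ∑ i, ∑ j, gaussianPairing v (Φ i j) ((genericMatrix ι ^ k) i j) =
      v ^ k * gaussianPairing v (traceDivergencePow k Φ) 1 := by
  induction k generalizing Φ with
  | zero =>
    rw [traceDivergencePow_zero, Matrix.trace, gaussianPairing_sum_left]
    simp only [pow_zero, one_mul]
    refine Finset.sum_congr rfl fun i _ => ?_
    rw [Finset.sum_eq_single i]
    · simp
    · intro j _ hj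
      simp [Matrix.one_apply_ne hj.symm, gaussianPairing]
    · simp
  | succ k ih =>
    rw [pow_succ' (genericMatrix ι), sum_gaussianPairing_generic_mul hv, ih,
      traceDivergencePow_succ, pow_succ']
    ring

/-- `E ‖G^k‖_F²` for a complex Ginibre matrix `G`. -/
theorem sum_gaussianPairing_generic_pow_self {v : ℝ≥0} (hv : v ≠ 0) (k : ℕ) :
    ∑ i, ∑ j, gaussianPairing v ((genericMatrix ι ^ k) i j) ((genericMatrix ι ^ k) i j) =
      v ^ k * ((((Fintype.card ι).ascFactorial (k + 2) : ℂ) -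
        ((Fintype.card ι).descFactorial (k + 2) : ℂ)) / (((k : ℂ) + 1) * ((k : ℂ) + 2))) := by
  rw [sum_gaussianPairing_generic_pow hv, traceDivergencePow_genericMatrix_pow]
  congr 1
  simp [gaussianPairing]

theorem isHomogeneous_genericMatrix_pow (k : ℕ) (i j : ι) :
    ((genericMatrix ι ^ k) i j).IsHomogeneous k := by
  induction k generalizing i j with
  | zero =>
    rw [pow_zero, Matrix.one_apply]
    split_ifs
    · exact isHomogeneous_one _ _
    · exact isHomogeneous_zero _ _ _
  | succ k ih =>
    rw [pow_succ, Matrix.mul_apply]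
    exact IsHomogeneous.sum _ _ _ fun l _ => (ih i l).mul (isHomogeneous_X _ _)

end PolynomialPairing

/-! ### Second moments of the hidden states -/

section RecurrentStates

open MvPolynomial

variable {n : ℕ}

theorem rnnState_eq (W : Matrix (Fin n) (Fin n) ℂ) (x0 : Fin n → ℝ) (k : ℕ) :
    rnnState W x0 k = (W ^ k).mulVec (complexify x0) := by
  induction k with
  | zero => simp [rnnState]
  | succ k ih => rw [rnnState, ih, Matrix.mulVec_mulVec, pow_succ']

theorem lruState_eq (W : Matrix (Fin n) (Fin n) ℂ) (x : ℕ → Fin n → ℝ) (t : ℕ) :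
    lruState W x t =
      ∑ s ∈ Finset.range (t + 1), (W ^ (t - s)).mulVec (complexify (x s)) := by
  induction t with
  | zero => simp [lruState]
  | succ t ih =>
    rw [lruState, ih, Finset.sum_range_succ _ (t + 1), Matrix.mulVec_sum]
    congr 1
    · refine Finset.sum_congr rfl fun s hs => ?_
      rw [Matrix.mulVec_mulVec, ← pow_succ', Nat.succ_sub (Finset.mem_range_succ_iff.1 hs)]
    · simp

theorem ofReal_sqNorm (h : Fin n → ℂ) :
    ((sqNorm h : ℝ) : ℂ) = ∑ i, h i * (starRingEnd ℂ) (h i) := by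
  rw [sqNorm, EuclideanSpace.norm_sq_eq]
  simp [Complex.mul_conj, Complex.normSq_eq_norm_sq]

theorem eval_genericMatrix_pow (W : Matrix (Fin n) (Fin n) ℂ) (k : ℕ) (i j : Fin n) :
    eval (fun p => W p.1 p.2) ((genericMatrix (Fin n) ^ k) i j) = (W ^ k) i j := by
  have hG : (genericMatrix (Fin n)).map (eval fun p => W p.1 p.2) = W := by
    ext1 i j
    simp [genericMatrix]
  calc eval (fun p => W p.1 p.2) ((genericMatrix (Fin n) ^ k) i j)
      = ((genericMatrix (Fin n) ^ k).map (eval fun p => W p.1 p.2)) i j := rfl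
    _ = (W ^ k) i j := by rw [Matrix.map_pow, hG]

theorem ofReal_sqNorm_sum_pow_mulVec (W : Matrix (Fin n) (Fin n) ℂ) (S : Finset ℕ) (d : ℕ → ℕ)
    (x : ℕ → Fin n → ℝ) :
    ((sqNorm (∑ s ∈ S, (W ^ d s).mulVec (complexify (x s))) : ℝ) : ℂ) =
      ∑ i, ∑ s ∈ S, ∑ s' ∈ S, ∑ j, ∑ l,
        (eval (fun p => W p.1 p.2) ((genericMatrix (Fin n) ^ d s) i j) *
          (starRingEnd ℂ) (eval (fun p => W p.1 p.2) ((genericMatrix (Fin n) ^ d s') i l))) *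
            ((x s j * x s' l : ℝ) : ℂ) := by
  rw [ofReal_sqNorm]
  refine Finset.sum_congr rfl fun i _ => ?_
  simp only [Finset.sum_apply, map_sum, Finset.sum_mul_sum, Matrix.mulVec, dotProduct,
    eval_genericMatrix_pow, complexify, map_mul, Complex.conj_ofReal]
  refine Finset.sum_congr rfl fun s _ => Finset.sum_congr rfl fun s' _ =>
    Finset.sum_congr rfl fun j _ => Finset.sum_congr rfl fun l _ => ?_
  push_cast
  ring

variable {Ω : Type*} [MeasurableSpace Ω] {P : Measure Ω} {t : ℕ} {v : ℝ≥0}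
  {W : Ω → Matrix (Fin n) (Fin n) ℂ} {x : ℕ → Ω → Fin n → ℝ}

theorem integrable_mul_of_integrable_sq
    (hx_meas : ∀ s ≤ t, AEMeasurable (x s) P)
    (hx_sq : ∀ s ≤ t, ∀ i, Integrable (fun ω => x s ω i * x s ω i) P)
    {s s' : ℕ} (hs : s ≤ t) (hs' : s' ≤ t) (j l : Fin n) :
    Integrable (fun ω => x s ω j * x s' ω l) P := by
  have hm : ∀ s ≤ t, ∀ j, AEMeasurable (fun ω => x s ω j) P := fun s hs j =>
    (measurable_pi_apply j).comp_aemeasurable (hx_meas s hs)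
  refine ((hx_sq s hs j).add (hx_sq s' hs' l)).mono'
    ((hm s hs j).mul (hm s' hs' l)).aestronglyMeasurable (ae_of_all _ fun ω => ?_)
  rw [Pi.add_apply, Real.norm_eq_abs, abs_mul]
  nlinarith [sq_nonneg (|x s ω j| - |x s' ω l|), abs_mul_abs_self (x s ω j),
    abs_mul_abs_self (x s' ω l), abs_nonneg (x s ω j), abs_nonneg (x s' ω l)]

/-- Mixed expectations of polynomials in the weights and products of two inputs factor. -/
theorem integral_eval_mul_conj_eval_mul
    (hW : HasLaw (fun ω (p : Fin n × Fin n) => W ω p.1 p.2)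
      (Measure.pi fun _ => complexGaussian v) P)
    (hx_indep : IndepFun (fun (ω : Ω) (i j : Fin n) => W ω i j)
      (fun (ω : Ω) (s : Fin (t + 1)) => x (s : ℕ) ω) P)
    {s s' : ℕ} (hs : s ≤ t) (hs' : s' ≤ t) (j l : Fin n)
    (hint : Integrable (fun ω => x s ω j * x s' ω l) P)
    (f g : MvPolynomial (Fin n × Fin n) ℂ) :
    Integrable (fun ω => (eval (fun p => W ω p.1 p.2) f *
      (starRingEnd ℂ) (eval (fun p => W ω p.1 p.2) g)) * ((x s ω j * x s' ω l : ℝ) : ℂ)) P ∧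
    ∫ ω, (eval (fun p => W ω p.1 p.2) f *
      (starRingEnd ℂ) (eval (fun p => W ω p.1 p.2) g)) * ((x s ω j * x s' ω l : ℝ) : ℂ) ∂P =
        gaussianPairing v f g * ((∫ ω, x s ω j * x s' ω l ∂P : ℝ) : ℂ) := by
  have hcont : ∀ f : MvPolynomial (Fin n × Fin n) ℂ,
      Continuous fun w : Fin n → Fin n → ℂ => eval (fun p : Fin n × Fin n => w p.1 p.2) f :=
    fun f => (continuous_eval f).comp (by fun_prop)
  have hφ : Measurable fun w : Fin n → Fin n → ℂ =>
      eval (fun p : Fin n × Fin n => w p.1 p.2) f *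
        (starRingEnd ℂ) (eval (fun p : Fin n × Fin n => w p.1 p.2) g) :=
    ((hcont f).mul (Complex.continuous_conj.comp (hcont g))).measurable
  have hψ : Measurable fun y : Fin (t + 1) → Fin n → ℝ =>
      ((y ⟨s, Nat.lt_succ_of_le hs⟩ j * y ⟨s', Nat.lt_succ_of_le hs'⟩ l : ℝ) : ℂ) := by
    fun_prop
  have hind := hx_indep.comp hφ hψ
  have hfg := integrable_eval_mul_conj_eval v f g
  have hI : Integrable (fun ω => eval (fun p => W ω p.1 p.2) f *
      (starRingEnd ℂ) (eval (fun p => W ω p.1 p.2) g)) P := by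
    rw [← hW.map_eq] at hfg
    exact hfg.comp_aemeasurable hW.aemeasurable
  have hJ : Integrable (fun ω => ((x s ω j * x s' ω l : ℝ) : ℂ)) P := hint.ofReal
  refine ⟨hind.integrable_mul hI hJ, ?_⟩
  have h := hind.integral_mul_eq_mul_integral hI.aestronglyMeasurable hJ.aestronglyMeasurable
  refine h.trans ?_
  congr 1
  · exact hW.integral_comp (f := fun z => eval z f * (starRingEnd ℂ) (eval z g))
      hfg.aestronglyMeasurable
  · exact integral_ofReal

/-- Second moment of a combination `∑ W^{d s} x_s` with pairwise distinct exponents. -/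
theorem integral_sqNorm_sum_pow_mulVec (hv : v ≠ 0)
    (hW : HasLaw (fun ω (p : Fin n × Fin n) => W ω p.1 p.2)
      (Measure.pi fun _ => complexGaussian v) P)
    (hx_meas : ∀ s ≤ t, AEMeasurable (x s) P)
    (hx_indep : IndepFun (fun (ω : Ω) (i j : Fin n) => W ω i j)
      (fun (ω : Ω) (s : Fin (t + 1)) => x (s : ℕ) ω) P)
    (hx_cov : ∀ s ≤ t, ∀ i j, Integrable (fun ω => x s ω i * x s ω j) P ∧
      ∫ ω, x s ω i * x s ω j ∂P = (1 : Matrix (Fin n) (Fin n) ℝ) i j)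
    {S : Finset ℕ} (hS : ∀ s ∈ S, s ≤ t) {d : ℕ → ℕ} (hd : Set.InjOn d S) :
    Integrable (fun ω => sqNorm (∑ s ∈ S, (W ω ^ d s).mulVec (complexify (x s ω)))) P ∧
    ∫ ω, sqNorm (∑ s ∈ S, (W ω ^ d s).mulVec (complexify (x s ω))) ∂P =
      ∑ s ∈ S, (v : ℝ) ^ d s * (((n.ascFactorial (d s + 2) : ℝ) - (n.descFactorial (d s + 2) : ℝ)) /
        (((d s : ℝ) + 1) * ((d s : ℝ) + 2))) := by
  have hterm := fun (s : ℕ) (hs : s ∈ S) (s' : ℕ) (hs' : s' ∈ S) (j l : Fin n) =>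
    integral_eval_mul_conj_eval_mul hW hx_indep (hS s hs) (hS s' hs') j l
      (integrable_mul_of_integrable_sq hx_meas (fun s hs i => (hx_cov s hs i i).1)
        (hS s hs) (hS s' hs') j l)
  have hI1 := fun (i : Fin n) (s : ℕ) (hs : s ∈ S) (s' : ℕ) (hs' : s' ∈ S) (j : Fin n) =>
    integrable_finsetSum Finset.univ fun l _ => (hterm s hs s' hs' j l
      ((genericMatrix (Fin n) ^ d s) i j) ((genericMatrix (Fin n) ^ d s') i l)).1
  have hI2 := fun (i : Fin n) (s : ℕ) (hs : s ∈ S) (s' : ℕ) (hs' : s' ∈ S) =>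
    integrable_finsetSum Finset.univ fun j _ => hI1 i s hs s' hs' j
  have hI3 := fun (i : Fin n) (s : ℕ) (hs : s ∈ S) =>
    integrable_finsetSum S fun s' hs' => hI2 i s hs s' hs'
  have hI4 := fun (i : Fin n) => integrable_finsetSum S fun s hs => hI3 i s hs
  have hI5 := integrable_finsetSum Finset.univ fun i _ => hI4 i
  have hC : Integrable (fun ω =>
      ((sqNorm (∑ s ∈ S, (W ω ^ d s).mulVec (complexify (x s ω))) : ℝ) : ℂ)) P := by
    refine hI5.congr (ae_of_all _ fun ω => ?_)
    exact (ofReal_sqNorm_sum_pow_mulVec (W ω) S d fun s => x s ω).symm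
  refine ⟨by simpa using hC.re, Complex.ofReal_injective ?_⟩
  rw [← integral_complex_ofReal]
  -- For `s ≠ s'` the exponents differ, so degree orthogonality kills the term whatever the
  -- correlation of the inputs; for `s = s'` the identity covariance keeps only `j = l`.
  have hcross : ∀ i : Fin n, ∀ s ∈ S, ∀ s' ∈ S, ∀ j l : Fin n,
      gaussianPairing v ((genericMatrix (Fin n) ^ d s) i j) ((genericMatrix (Fin n) ^ d s') i l) *
        ((∫ ω, x s ω j * x s' ω l ∂P : ℝ) : ℂ) =
      if s = s' then if j = l then
        gaussianPairing v ((genericMatrix (Fin n) ^ d s) i j) ((genericMatrix (Fin n) ^ d s) i j)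
        else 0 else 0 := by
    intro i s hs s' hs' j l
    split_ifs with h h'
    · subst h h'
      simp [(hx_cov s (hS s hs) j j).2]
    · subst h
      simp [(hx_cov s (hS s hs) j l).2, Matrix.one_apply_ne h']
    · rw [gaussianPairing_eq_zero_of_isHomogeneous hv (isHomogeneous_genericMatrix_pow _ _ _)
        (isHomogeneous_genericMatrix_pow _ _ _) (fun e => h (hd hs hs' e)), zero_mul]
  calc ∫ ω, ((sqNorm (∑ s ∈ S, (W ω ^ d s).mulVec (complexify (x s ω))) : ℝ) : ℂ) ∂P
      = ∑ i, ∑ s ∈ S, ∑ s' ∈ S, ∑ j, ∑ l,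
          gaussianPairing v ((genericMatrix (Fin n) ^ d s) i j)
            ((genericMatrix (Fin n) ^ d s') i l) * ((∫ ω, x s ω j * x s' ω l ∂P : ℝ) : ℂ) := by
        simp only [ofReal_sqNorm_sum_pow_mulVec]
        rw [integral_finsetSum _ fun i _ => hI4 i]
        refine Finset.sum_congr rfl fun i _ => ?_
        rw [integral_finsetSum _ fun s hs => hI3 i s hs]
        refine Finset.sum_congr rfl fun s hs => ?_
        rw [integral_finsetSum _ fun s' hs' => hI2 i s hs s' hs']
        refine Finset.sum_congr rfl fun s' hs' => ?_
        rw [integral_finsetSum _ fun j _ => hI1 i s hs s' hs' j]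
        refine Finset.sum_congr rfl fun j _ => ?_
        rw [integral_finsetSum _ fun l _ => (hterm s hs s' hs' j l _ _).1]
        exact Finset.sum_congr rfl fun l _ => (hterm s hs s' hs' j l _ _).2
    _ = ∑ i, ∑ s ∈ S, ∑ j, gaussianPairing v ((genericMatrix (Fin n) ^ d s) i j)
          ((genericMatrix (Fin n) ^ d s) i j) := by
        refine Finset.sum_congr rfl fun i _ => Finset.sum_congr rfl fun s hs => ?_
        rw [Finset.sum_congr rfl fun s' hs' => Finset.sum_congr rfl fun j _ =>
          Finset.sum_congr rfl fun l _ => hcross i s hs s' hs' j l]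
        rw [Finset.sum_eq_single_of_mem s hs fun s' _ h => by simp [h.symm]]
        simp
    _ = _ := by
        rw [Finset.sum_comm]
        push_cast
        refine Finset.sum_congr rfl fun s _ => ?_
        rw [sum_gaussianPairing_generic_pow_self hv, Fintype.card_fin]

end RecurrentStates

/-! ### The energy decomposition and the closed form -/

theorem theorem1 {Ω : Type*} [MeasurableSpace Ω] (P : Measure Ω) [IsProbabilityMeasure P]
    (n t : ℕ) (hn : 0 < n)
    (W : Ω → Matrix (Fin n) (Fin n) ℂ)
    (hW_law : ∀ i j, HasLaw (fun ω => W ω i j) (complexGaussian (1 / (n : ℝ≥0))) P)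
    (hW_indep : iIndepFun (fun (p : Fin n × Fin n) (ω : Ω) => W ω p.1 p.2) P)
    (x : ℕ → Ω → Fin n → ℝ)
    (hx_meas : ∀ s ≤ t, AEMeasurable (x s) P)
    (hx_indep : IndepFun (fun (ω : Ω) (i j : Fin n) => W ω i j)
      (fun (ω : Ω) (s : Fin (t + 1)) => x (s : ℕ) ω) P)
    (hx_cov : ∀ s ≤ t, ∀ i j, Integrable (fun ω => x s ω i * x s ω j) P ∧
      ∫ ω, x s ω i * x s ω j ∂P = (1 : Matrix (Fin n) (Fin n) ℝ) i j) :
    Integrable (fun ω => sqNorm (lruState (W ω) (fun s => x s ω) t)) P ∧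
    lruEnergy P W x t = ∑ k ∈ Finset.range (t + 1), rnnEnergy P W x k ∧
    ∀ k : ℕ,
      Integrable (fun ω => sqNorm (rnnState (W ω) (x 0 ω) k)) P ∧
      rnnEnergy P W x k =
        ((n.ascFactorial (k + 2) : ℝ) - (n.descFactorial (k + 2) : ℝ)) /
          ((n : ℝ) ^ (k + 1) * ((k : ℝ) + 1) * ((k : ℝ) + 2)) := by
  have hn' : (n : ℝ) ≠ 0 := by exact_mod_cast hn.ne'
  have hv : (1 / (n : ℝ≥0)) ≠ 0 := one_div_ne_zero (by exact_mod_cast hn.ne')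
  have hW : HasLaw (fun ω (p : Fin n × Fin n) => W ω p.1 p.2)
      (Measure.pi fun _ => complexGaussian (1 / (n : ℝ≥0))) P :=
    hW_indep.hasLaw_pi fun p => hW_law p.1 p.2
  have hlru := integral_sqNorm_sum_pow_mulVec hv hW hx_meas hx_indep hx_cov
    (S := Finset.range (t + 1)) (fun s hs => Finset.mem_range_succ_iff.1 hs)
    (d := fun s => t - s) (by
      intro a ha b hb h
      have ha' := Finset.mem_range_succ_iff.1 (Finset.mem_coe.1 ha)
      have hb' := Finset.mem_range_succ_iff.1 (Finset.mem_coe.1 hb)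
      simp only at h
      omega)
  -- The RNN state is the one-term combination `W^k x_0`, so the same second-moment formula covers
  -- it.
  have hrnn := fun k : ℕ => integral_sqNorm_sum_pow_mulVec hv hW hx_meas hx_indep hx_cov
    (S := {0}) (by simp) (d := fun _ => k) (by simp)
  simp only [Finset.sum_singleton] at hrnn
  simp only [lruEnergy, rnnEnergy, signalEnergy, lruState_eq, rnnState_eq]
  refine ⟨hlru.1, ?_, fun k => ⟨(hrnn k).1, ?_⟩⟩
  -- Input `s` carries exponent `t - s`; reversing the sum indexes it by `k = t - s`.
  · rw [hlru.2, ← Finset.mul_sum, ← Finset.sum_range_reflect]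
    congr 1
    refine Finset.sum_congr rfl fun k hk => ?_
    rw [(hrnn k).2, Nat.add_sub_cancel, Nat.sub_sub_self (Finset.mem_range_succ_iff.1 hk)]
  · rw [(hrnn k).2]
    have hk1 : (k : ℝ) + 1 ≠ 0 := by positivity
    have hk2 : (k : ℝ) + 2 ≠ 0 := by positivity
    push_cast
    rw [one_div, inv_pow, pow_succ]
    field_simp
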